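/- **Setting.** All graphs are finite, simple, undirected and connected. Fix $n$ and $\Delta$. A *labeled graph* is a graph $G$ on $n$ nodes with an input label, from a finite set $\Sigma$, at every pair $(v,e)$, where $e$ is an edge and $v$ is an endpoint of $e$. A class of labeled graphs *contains an orientation of each edge* if the label at $(v,e)$ determines, by a rule fixed for the whole class, an orientation of $e$ relative to $v$ (towards or away from $v$), and the two endpoints of each edge agree on its orientation. The nodes of a $\Delta$-regular labeled graph are given port numberings, i.e. for each node a bijection between $\{1,\dots,\Delta\}$ and its incident edges. All port numberings are allowed. *Neighborhoods.* The radius-$t$ neighborhood $N^t(v)$ of a node $v$ consists of the subgraph induced by the nodes at distance at most $t$ from $v$, the port numbers at both ends of its edges, and, for each of these nodes, the input label (and, if there are identifiers, the identifier) that the node initially holds at each of its ports. For an edge $e=\{u,v\}$ let $N^t(e)=N^t(u)\cap N^t(v)$ be the corresponding information on the nodes at distance at most $t$ from both $u$ and $v$. Isomorphisms of neighborhoods preserve all this information and the center (the node $v$, resp. the endpoints $u,v$). *$t$-independence.* Let $t\ge 1$. A class $\mathcal G$ of $\Delta$-regular labeled graphs on $n$ nodes is *$t$-independent* if for every $G\in\mathcal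 G$ (with any port numbering) the following two conditions hold. 1. For every edge $e=\{u,v\}$ of $G$: whenever $H_1,H_2\in\mathcal G$ have edges $e_1=\{u_1,v_1\}$, $e_2=\{u_2,v_2\}$ with isomorphisms $N^t_G(e)\cong N^t_{H_1}(e_1)$ and $N^t_G(e)\cong N^t_{H_2}(e_2)$ ($u,v$ corresponding to $u_i,v_i$), there are $H\in\mathcal G$ and an edge $e'=\{u',v'\}$ of $H$ with $N^t_H(e')\cong N^t_G(e)$, $N^t_H(v')\cong N^t_{H_1}(v_1)$ and $N^t_H(u')\cong N^t_{H_2}(u_2)$, where the isomorphisms are compatible on $N^t_G(e)$. 2. For every node $v$ of $G$: whenever, for each port $i$ of $v$, $H_i\in\mathcal G$ has a node $w_i$ with an isomorphism $N^{t-1}_G(v)\cong N^{t-1}_{H_i}(w_i)$, there are $H\in\mathcal G$ and a node $w$ of $H$ with $N^{t-1}_H(w)\cong N^{t-1}_G(v)$ such that for each $i$ the neighborhood $N^t_H$ of the edge at port $i$ of $w$ is isomorphic to the neighborhood $N^t_{H_i}$ of the edge at port $i$ of $w_i$ ($w$ corresponding to $w_i$), where the isomorphisms are compatible on $N^{t-1}_G(v)$.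 *Algorithms.* A deterministic algorithm runs in time $t$ on a class of labeled graphs with identifiers if the outputs of each node $v$ (one at each of its ports) are a function of the isomorphism type of $N^t(v)$, identifiers included. It is *order-invariant* if the outputs of $v$ depend on the identifiers in $N^t(v)$ only through their relative order. *Superweak $k$-coloring.* Each node $v$ outputs at each $(v,e)$ a pair consisting of a color from $\{1,\dots,k\}$ and one of the symbols $\rightarrow$ (demanding), $\multimap$ (accepting), $\bullet$ (none). At each node all $\Delta$ colors are equal, the number of $\rightarrow$ is strictly greater than the number of $\multimap$, and the number of $\multimap$ is at most $k$. For each edge with outputs $(y,y')$ and $(z,z')$ at its two endpoints, $y\ne z$, or $y'=z'=\bullet$, or $\multimap\,\in\{y',z'\}$. **Lemma.** Let $k\ge 2$, $\Delta\ge 2^{4^k+1}$, $n\ge 0$ and $t\ge 1$ be integers. Let $\mathcal G$ be a class of $\Delta$-regular labeled graphs on $n$ nodes that contains an orientation of each edge, is $t$-independent, and contains only graphs of girth at least $2t+2$. Let $S$ be a finite set of positive integers with $|S|\ge 4\Delta^{2t}$, and let $\mathcal G'$ be the class of all labeled graphs with identifiers obtained by taking a graph from $\mathcal G$ and assigning pairwise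 distinct identifiers from $S$ to its nodes. Set $k'=2^{2^{5^k}}$. If there is an order-invariant algorithm that solves superweak $k$-coloring on $\mathcal G'$ (for all port numberings) in time $t$, then there is an order-invariant algorithm that solves superweak $k'$-coloring on $\mathcal G'$ (for all port numberings) in time $t-1$. -/

import Mathlib

namespace SuperweakSpeedup

/-- A connected simple graph on `n` nodes with input labels from `Λ` on the pairs `(v, e)`, where
`v` is an endpoint of the edge `e`. Such a pair is a dart: `(v, {v, w})` is the dart from `v` to
`w`. -/
structure LabeledGraph (n : ℕ) (Λ : Type*) where
  graph : SimpleGraph (Fin n)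
  connected : graph.Connected
  label : graph.Dart → Λ

/-- Every node has exactly `Δ` neighbors. -/
def LabeledGraph.IsRegular {n : ℕ} {Λ : Type*} (G : LabeledGraph n Λ) (Δ : ℕ) : Prop :=
  ∀ v : Fin n, (G.graph.neighborSet v).ncard = Δ

/-- The input labels in the class contain an orientation of every edge: a fixed rule `out` reads
off the label at `(v, e)` whether `e` is oriented away from `v` (`true`) or towards `v` (`false`),
and the two endpoints of an edge agree on its orientation. -/
def ContainsOrientation {n : ℕ} {Λ : Type*} (𝒢 : Set (LabeledGraph n Λ)) : Prop :=
  ∃ out : Λ → Bool, ∀ G ∈ 𝒢, ∀ d : G.graph.Dart, out (G.label d.symm) = !(out (G.label d))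

/-- A labeled graph together with a port numbering: the ports of each node are in bijection with
its incident edges, that is, with its neighbors. (This forces the graph to be `Δ`-regular.) -/
structure PortedGraph (n Δ : ℕ) (Λ : Type*) extends LabeledGraph n Λ where
  port : ∀ v : Fin n, Fin Δ ≃ graph.neighborSet v

namespace PortedGraph

variable {n Δ : ℕ} {Λ : Type*}

/-- The neighbor of `v` behind port `i`. -/
def nbr (P : PortedGraph n Δ Λ) (v : Fin n) (i : Fin Δ) : Fin n :=
  (P.port v i : Fin n)

/-- The input label at `(v, e)`, where `e` is the edge at port `i` of `v`. -/
def portLabel (P : PortedGraph n Δ Λ) (v : Fin n) (i : Fin Δ) : Λ :=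
  P.label ⟨(v, (P.port v i : Fin n)), (P.port v i).2⟩

/-- The nodes of the radius-`t` neighborhood of the node `v`. -/
def nodeNbhd (P : PortedGraph n Δ Λ) (t : ℕ) (v : Fin n) : Set (Fin n) :=
  {x | P.graph.dist v x ≤ t}

/-- The nodes of the radius-`t` neighborhood of the edge `{u, v}`: what both endpoints see. -/
def edgeNbhd (P : PortedGraph n Δ Λ) (t : ℕ) (u v : Fin n) : Set (Fin n) :=
  P.nodeNbhd t u ∩ P.nodeNbhd t v

/-- `φ` is an isomorphism from the information that `P` holds on the node set `X` to the
information that `Q` holds on the node set `Y`. This information is the induced subgraph, with the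
port numbers at both ends of its edges, and the initial knowledge of each node of the set: its
input label at each of its ports, also at those whose edges leave the set.
(Values of `φ` outside `X` are irrelevant.) -/
structure IsIso (P Q : PortedGraph n Δ Λ) (X Y : Set (Fin n)) (φ : Fin n → Fin n) : Prop where
  bijOn : Set.BijOn φ X Y
  label_eq : ∀ x ∈ X, ∀ i : Fin Δ, Q.portLabel (φ x) i = P.portLabel x i
  nbr_iff : ∀ x ∈ X, ∀ y ∈ X, ∀ i : Fin Δ, P.nbr x i = y ↔ Q.nbr (φ x) i = φ y

/-- `φ` is an isomorphism from `N^t_P(v)` to `N^t_Q(w)`. -/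
def IsNodeIso (t : ℕ) (P : PortedGraph n Δ Λ) (v : Fin n) (Q : PortedGraph n Δ Λ) (w : Fin n)
    (φ : Fin n → Fin n) : Prop :=
  φ v = w ∧ IsIso P Q (P.nodeNbhd t v) (Q.nodeNbhd t w) φ

/-- `φ` is an isomorphism from `N^t_P({u, v})` to `N^t_Q({u', v'})` under which `u`, `v`
correspond to `u'`, `v'`. -/
def IsEdgeIso (t : ℕ) (P : PortedGraph n Δ Λ) (u v : Fin n) (Q : PortedGraph n Δ Λ)
    (u' v' : Fin n) (φ : Fin n → Fin n) : Prop :=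
  φ u = u' ∧ φ v = v' ∧ IsIso P Q (P.edgeNbhd t u v) (Q.edgeNbhd t u' v') φ

end PortedGraph

open PortedGraph in
/-- First half of `t`-independence: the extensions of the radius-`t` neighborhood of an edge
`{u, v}` to the radius-`t` neighborhoods of `u` and of `v` can be combined freely.

An extension along `v` that is possible in the class is given by a graph `H₁` of the class, an edge
`{u₁, v₁}` of it and an isomorphism `φ₁` of the edge neighborhoods: it is `N^t(v₁)` without the
image of `φ₁`. An extension along `u` is given in the same way by `H₂`, `u₂`, `v₂`, `φ₂`. Some
graph `H` of the class realizes both of them at once, compatibly with `φ₁` and `φ₂`. -/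
def EdgeIndependent {n : ℕ} {Λ : Type*} (Δ : ℕ) (𝒢 : Set (LabeledGraph n Λ)) (t : ℕ) : Prop :=
  ∀ G : PortedGraph n Δ Λ, G.toLabeledGraph ∈ 𝒢 → ∀ u v : Fin n, G.graph.Adj u v →
  ∀ H₁ : PortedGraph n Δ Λ, H₁.toLabeledGraph ∈ 𝒢 → ∀ u₁ v₁ : Fin n, H₁.graph.Adj u₁ v₁ →
  ∀ φ₁ : Fin n → Fin n, IsEdgeIso t G u v H₁ u₁ v₁ φ₁ →
  ∀ H₂ : PortedGraph n Δ Λ, H₂.toLabeledGraph ∈ 𝒢 → ∀ u₂ v₂ : Fin n, H₂.graph.Adj u₂ v₂ →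
  ∀ φ₂ : Fin n → Fin n, IsEdgeIso t G u v H₂ u₂ v₂ φ₂ →
  ∃ H : PortedGraph n Δ Λ, H.toLabeledGraph ∈ 𝒢 ∧ ∃ u' v' : Fin n, H.graph.Adj u' v' ∧
  ∃ χ : Fin n → Fin n, IsEdgeIso t G u v H u' v' χ ∧
    (∃ ψ₁ : Fin n → Fin n, IsNodeIso t H₁ v₁ H v' ψ₁ ∧
      Set.EqOn (ψ₁ ∘ φ₁) χ (G.edgeNbhd t u v)) ∧
    (∃ ψ₂ : Fin n → Fin n, IsNodeIso t H₂ u₂ H u' ψ₂ ∧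
      Set.EqOn (ψ₂ ∘ φ₂) χ (G.edgeNbhd t u v))

open PortedGraph in
/-- Second half of `t`-independence: the extensions of the radius-`(t-1)` neighborhood of a node
`v` to the radius-`t` neighborhoods of its incident edges can be combined freely.

The incident edges of `v` are indexed by the ports of `v`, and corresponding edges have the same
port. An extension along the edge at port `i` that is possible in the class is given by a graph
`H i` of the class, a node `w i` of it and an isomorphism `φ i` of the node neighborhoods. -/
def NodeIndependent {n : ℕ} {Λ : Type*} (Δ : ℕ) (𝒢 : Set (LabeledGraph n Λ)) (t : ℕ) : Prop :=
  ∀ G : PortedGraph n Δ Λ, G.toLabeledGraph ∈ 𝒢 → ∀ v : Fin n,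
  ∀ H : Fin Δ → PortedGraph n Δ Λ, (∀ i, (H i).toLabeledGraph ∈ 𝒢) → ∀ w : Fin Δ → Fin n,
  ∀ φ : Fin Δ → Fin n → Fin n, (∀ i, IsNodeIso (t - 1) G v (H i) (w i) (φ i)) →
  ∃ K : PortedGraph n Δ Λ, K.toLabeledGraph ∈ 𝒢 ∧ ∃ x : Fin n,
  ∃ χ : Fin n → Fin n, IsNodeIso (t - 1) G v K x χ ∧
    ∀ i : Fin Δ, ∃ ψ : Fin n → Fin n,
      IsEdgeIso t (H i) (w i) ((H i).nbr (w i) i) K x (K.nbr x i) ψ ∧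
      Set.EqOn (ψ ∘ φ i) χ (G.nodeNbhd (t - 1) v)

/-- `t`-independence (for positive `t`) of a class of `Δ`-regular labeled graphs on `n` nodes. -/
def IsIndependent {n : ℕ} {Λ : Type*} (Δ : ℕ) (𝒢 : Set (LabeledGraph n Λ)) (t : ℕ) : Prop :=
  EdgeIndependent Δ 𝒢 t ∧ NodeIndependent Δ 𝒢 t

/-- What an algorithm is run on: a labeled graph with a port numbering and identifiers. -/
structure Network (n Δ : ℕ) (Λ : Type*) extends PortedGraph n Δ Λ where
  ident : Fin n → ℕ+

/-- The networks obtained from the graphs of the class `𝒢` by assigning unique identifiers from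
`S` to the nodes (and an arbitrary port numbering). -/
def withIdents {n : ℕ} {Λ : Type*} (Δ : ℕ) (𝒢 : Set (LabeledGraph n Λ)) (S : Finset ℕ+) :
    Set (Network n Δ Λ) :=
  {I | I.toLabeledGraph ∈ 𝒢 ∧ Function.Injective I.ident ∧ ∀ v, I.ident v ∈ S}

/-- A deterministic algorithm, given through its outputs: `A I v i` is the output of the node `v`
of the network `I` at port `i`. -/
abbrev Algorithm (n Δ : ℕ) (Λ O : Type*) : Type _ :=
  Network n Δ Λ → Fin n → Fin Δ → O

/-- On the networks in `𝒩`, `A` runs in time `t`: the output of a node is a function of the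
isomorphism type of its radius-`t` neighborhood, identifiers included. -/
def RunsInTime {n Δ : ℕ} {Λ O : Type*} (A : Algorithm n Δ Λ O) (𝒩 : Set (Network n Δ Λ))
    (t : ℕ) : Prop :=
  ∀ I ∈ 𝒩, ∀ J ∈ 𝒩, ∀ v w : Fin n, ∀ φ : Fin n → Fin n,
    PortedGraph.IsNodeIso t I.toPortedGraph v J.toPortedGraph w φ →
    (∀ x ∈ I.nodeNbhd t v, J.ident (φ x) = I.ident x) →
    A I v = A J w

/-- On the networks in `𝒩`, the time-`t` algorithm `A` is order-invariant: the output of a node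
does not change if the identifiers that it sees are replaced by others in the same order. -/
def IsOrderInvariant {n Δ : ℕ} {Λ O : Type*} (A : Algorithm n Δ Λ O) (𝒩 : Set (Network n Δ Λ))
    (t : ℕ) : Prop :=
  ∀ I ∈ 𝒩, ∀ J ∈ 𝒩, ∀ v w : Fin n, ∀ φ : Fin n → Fin n,
    PortedGraph.IsNodeIso t I.toPortedGraph v J.toPortedGraph w φ →
    (∀ x ∈ I.nodeNbhd t v, ∀ y ∈ I.nodeNbhd t v,
      J.ident (φ x) < J.ident (φ y) ↔ I.ident x < I.ident y) →
    A I v = A J w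

/-- A problem, for a fixed maximum degree, with output labels from `O`: the allowed two-element
multisets of outputs at an edge, and the allowed multisets of outputs around a node. -/
structure Problem (O : Type*) where
  edge : Set (Sym2 O)
  node : Set (Multiset O)

/-- The outputs of `A` are correct on all networks in `𝒩`, at each node and at each edge. The edge
at port `i` of `v` has the port `j` at its other endpoint. -/
def Solves {n Δ : ℕ} {Λ O : Type*} (A : Algorithm n Δ Λ O) (𝒩 : Set (Network n Δ Λ))
    (prob : Problem O) : Prop :=
  ∀ I ∈ 𝒩,
    (∀ v : Fin n, (Finset.univ : Finset (Fin Δ)).val.map (A I v) ∈ prob.node) ∧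
    (∀ (v : Fin n) (i j : Fin Δ), I.nbr (I.nbr v i) j = v →
      s(A I v i, A I (I.nbr v i) j) ∈ prob.edge)

/-- There is an order-invariant algorithm that solves `prob` on `𝒩` in time `t`. -/
def OrderInvariantlySolvable {n Δ : ℕ} {Λ O : Type*} (prob : Problem O) (𝒩 : Set (Network n Δ Λ))
    (t : ℕ) : Prop :=
  ∃ A : Algorithm n Δ Λ O, RunsInTime A 𝒩 t ∧ IsOrderInvariant A 𝒩 t ∧ Solves A 𝒩 prob

/-- The second components of the outputs for superweak coloring. -/
inductive Pointer : Type
  | demanding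
  | accepting
  | none
  deriving DecidableEq

/-- Superweak `k`-coloring on `Δ`-regular graphs; the colors are the elements of `Fin k`. -/
def superweakColoring (k Δ : ℕ) : Problem (Fin k × Pointer) where
  edge := {p | ∃ (y z : Fin k) (y' z' : Pointer), p = s((y, y'), (z, z')) ∧
    (y ≠ z ∨ (y' = Pointer.none ∧ z' = Pointer.none) ∨
      (y' = Pointer.accepting ∨ z' = Pointer.accepting))}
  node := {m | m.card = Δ ∧ (∃ c : Fin k, ∀ p ∈ m, p.1 = c) ∧
    m.countP (fun p => p.2 = Pointer.accepting) <
      min (k + 1) (m.countP (fun p => p.2 = Pointer.demanding))}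

end SuperweakSpeedup

/-!
Round elimination for superweak coloring. Call a vector of weights `0`, `1`, `2`, one for each
color, a weight vector; the weights stand for the pointers `accepting`, `none`, `demanding`.

Let `A` be the given algorithm. The neighborhood of radius `t` of an edge leaves a set of possible
outputs of `A` at each half of the edge (`halfOutputs`). By independence at edges, any two outputs
from the two sets occur together (`mem_edge_of_mem_halfOutputs`), so that the weight vectors of the
two sets, which record the largest weight of each color, sum to at most `2` at each color (`Fits`).
The neighborhood of radius `t - 1` of a node `v` leaves, at each port, a set of possible weight
vectors, which together with the orientation of the edge is the type of the port (`portType`). By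
independence at nodes, any selection of one possible vector at each port occurs at some node
(`exists_halfOutputs_eq`). As `A` is correct there, some color has fewer weights `0` than weights
`2` in the selection, and at most `k` weights `0` (`exists_color_of_mem_node`).

Both independence statements concern graphs without identifiers. As `A` only depends on the order of
identifiers, it suffices to merge the orders on several views into one order on the nodes of the
combined graph (`exists_common_ident`). This works if the views overlap only in a core on which they
agree, which at a node is a consequence of the girth bound (`dist_lt_of_two_neighbors`).

Now join an outgoing and an incoming port type if they contain weight vectors that fit together
(`Linked`). If the ports of `v` had a perfect matching along this relation, then choosing fitting
vectors at matched ports would give a selection that contradicts the above. So Hall's condition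
fails: some set `D` of port types of one orientation has more ports than its set of neighbors does.
With a matching that covers only boundedly many ports of each type, the same argument bounds the
number of neighboring ports (`exists_isViolator`); there the matchings of outgoing and of incoming
ports are combined by the Mendelsohn–Dulmage theorem (`exists_matching_covering_both`). The new
algorithm takes `D` as the color of `v`, demands at the ports with types in `D`, and accepts at the
ports with types that are neighbors of `D`. The types of the two ends of an edge are always joined,
so that, if both endpoints choose the same `D` and one of them demands, the other one accepts.
-/

namespace SuperweakSpeedup

/-! ### Matchings -/

/-- The elements reached from points of `X` that are not of the form `g y`, `y ∈ Y`, by alternately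
following `f` from `X` and `g` from `Y`. -/
inductive AlternatingReach {α β : Type*} (X : Set α) (Y : Set β) (f : α → β) (g : β → α) : α → Prop
  | start {x : α} : x ∈ X → x ∉ g '' Y → AlternatingReach X Y f g x
  | step {x : α} : x ∈ X → AlternatingReach X Y f g x → f x ∈ Y → AlternatingReach X Y f g (g (f x))

/-- The Mendelsohn–Dulmage theorem: if one matching covers `X` and another one covers `Y`, then a
single matching covers both. -/
theorem exists_matching_covering_both {α β : Type*} {r : α → β → Prop} {X : Set α} {Y : Set β}
    {f : α → β} {g : β → α} (hf : Set.InjOn f X) (hfr : ∀ x ∈ X, r x (f x))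
    (hg : Set.InjOn g Y) (hgr : ∀ y ∈ Y, r (g y) y) :
    ∃ M : α → β → Prop, (∀ a b, M a b → r a b) ∧ (∀ a b b', M a b → M a b' → b = b') ∧
      (∀ a a' b, M a b → M a' b → a = a') ∧ (∀ a ∈ X, ∃ b, M a b) ∧ ∀ b ∈ Y, ∃ a, M a b := by
  -- Use `f` on the alternating paths that start outside the range of `g`, and `g` elsewhere.
  refine ⟨fun a b => (a ∈ X ∧ AlternatingReach X Y f g a ∧ f a = b) ∨
    (b ∈ Y ∧ ¬ AlternatingReach X Y f g a ∧ g b = a), ?_, ?_, ?_, ?_, ?_⟩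
  · rintro a b (⟨ha, -, rfl⟩ | ⟨hb, -, rfl⟩)
    exacts [hfr a ha, hgr b hb]
  · rintro a b b' (⟨ha, hA, rfl⟩ | ⟨hb, hA, rfl⟩) (⟨ha', hA', h⟩ | ⟨hb', hA', h⟩)
    exacts [h, absurd hA hA', absurd hA' hA, hg hb hb' h.symm]
  · rintro a a' b (⟨ha, hA, rfl⟩ | ⟨hb, hA, rfl⟩) (⟨ha', hA', h⟩ | ⟨hb', hA', h⟩)
    · exact hf ha ha' h.symm
    · exact absurd (h ▸ AlternatingReach.step ha hA hb') hA'
    · subst h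
      exact absurd (AlternatingReach.step ha' hA' hb) hA
    · exact h
  · intro a ha
    by_cases hA : AlternatingReach X Y f g a
    · exact ⟨f a, Or.inl ⟨ha, hA, rfl⟩⟩
    · have : a ∈ g '' Y := by
        by_contra h
        exact hA (.start ha h)
      obtain ⟨b, hb, rfl⟩ := this
      exact ⟨b, Or.inr ⟨hb, hA, rfl⟩⟩
  · intro b hb
    by_cases hA : AlternatingReach X Y f g (g b)
    · generalize hx : g b = x at hA
      cases hA with
      | start _ h => exact absurd ⟨b, hb, hx⟩ h
      | @step a ha hA hY => exact ⟨a, Or.inl ⟨ha, hA, hg hY hb hx.symm⟩⟩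
    · exact ⟨g b, Or.inr ⟨hb, hA, rfl⟩⟩

open Classical in
/-- Let the points `p` of a finite set have types `τ p`, and let `r` be a bipartite symmetric
relation on the types. Suppose that no set `D` of types from one side violates Hall's condition with
few neighbors. Then the points have a partial matching along `r` such that every unmatched point has
the type of more than `m` points that are all matched to points of one and the same type. -/
theorem exists_matching_of_forall_not_violating {P T : Type*} [Fintype P] [Fintype T] (τ : P → T)
    (side : T → Bool) (r : T → T → Prop) (hsymm : ∀ a b, r a b → r b a)
    (hside : ∀ a b, r a b → side a ≠ side b) (m K : ℕ)
    (hK : (m * Fintype.card T + 1) * Fintype.card T ≤ K + 1)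
    (h : ∀ D : Set T, (∃ b, ∀ a ∈ D, side a = b) →
      ¬ (Finset.univ.filter fun p => ∃ a ∈ D, r a (τ p)).card <
        min (K + 1) (Finset.univ.filter fun p => τ p ∈ D).card) :
    ∃ M : P → P → Prop, (∀ p q, M p q → M q p) ∧ (∀ p q q', M p q → M p q' → q = q') ∧
      (∀ p q, M p q → r (τ p) (τ q)) ∧
      ∀ p, (∃ q, M p q) ∨
        ∃ b, m < (Finset.univ.filter fun p' => τ p' = τ p ∧ ∃ q, M p' q ∧ τ q = b).card := by
  set B := m * Fintype.card T + 1 with hB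
  -- From each type, keep `B` points, or all of them if there are fewer.
  have hX : ∀ a : T, ∃ s : Finset P, (∀ p ∈ s, τ p = a) ∧ s.card ≤ B ∧
      ((∀ p, τ p = a → p ∈ s) ∨ s.card = B) := by
    intro a
    by_cases hc : (Finset.univ.filter fun p => τ p = a).card ≤ B
    · exact ⟨Finset.univ.filter fun p => τ p = a, by simp, hc, Or.inl (by simp)⟩
    · obtain ⟨s, hs, hsc⟩ := Finset.exists_subset_card_eq (le_of_not_ge hc)
      exact ⟨s, fun p hp => (Finset.mem_filter.1 (hs hp)).2, hsc.le, Or.inr hsc⟩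
  choose s hsτ hsB hs using hX
  set X : Finset P := Finset.univ.biUnion s with hXdef
  have hXcard : X.card ≤ K + 1 := by
    refine le_trans Finset.card_biUnion_le (le_trans (Finset.sum_le_card_nsmul _ _ B ?_) ?_)
    · intro a _
      exact hsB a
    · simpa [mul_comm] using hK
  -- Few points are kept, so Hall's condition holds for the kept points of either side.
  have hall : ∀ b : Bool, ∃ f : P → P,
      Set.InjOn f {p | p ∈ X ∧ side (τ p) = b} ∧
      ∀ p ∈ {p | p ∈ X ∧ side (τ p) = b}, r (τ p) (τ (f p)) := by
    intro b
    let t : {p // p ∈ X ∧ side (τ p) = b} → Finset P :=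
      fun p => Finset.univ.filter fun q => r (τ p) (τ q)
    have key : ∀ A : Finset {p // p ∈ X ∧ side (τ p) = b}, A.card ≤ (A.biUnion t).card := by
      intro A
      obtain ⟨D, hAD⟩ : ∃ D : Set T, ∀ a, a ∈ D ↔ ∃ p ∈ A, τ p.1 = a := ⟨_, fun _ => Iff.rfl⟩
      have hD := h D ⟨b, fun a ha => by
        obtain ⟨p, -, rfl⟩ := (hAD a).1 ha
        exact p.2.2⟩
      rw [not_lt] at hD
      refine le_trans (le_min ?_ ?_) (hD.trans (Finset.card_le_card fun q hq => ?_))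
      · refine le_trans ?_ hXcard
        rw [← Finset.card_map (Function.Embedding.subtype _)]
        refine Finset.card_le_card fun p hp => ?_
        obtain ⟨p', -, rfl⟩ := Finset.mem_map.1 hp
        exact p'.2.1
      · rw [← Finset.card_map (Function.Embedding.subtype _)]
        refine Finset.card_le_card fun p hp => ?_
        obtain ⟨p', hp', rfl⟩ := Finset.mem_map.1 hp
        exact Finset.mem_filter.2 ⟨Finset.mem_univ _, (hAD _).2 ⟨p', hp', rfl⟩⟩
      · obtain ⟨-, a, ha, hr⟩ := Finset.mem_filter.1 hq
        obtain ⟨p, hp, rfl⟩ := (hAD a).1 ha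
        exact Finset.mem_biUnion.2 ⟨p, hp, Finset.mem_filter.2 ⟨Finset.mem_univ _, hr⟩⟩
    obtain ⟨f, hf, hft⟩ := (Finset.all_card_le_biUnion_card_iff_exists_injective t).1 key
    refine ⟨fun p => if hp : p ∈ X ∧ side (τ p) = b then f ⟨p, hp⟩ else p, ?_, ?_⟩
    · intro p hp q hq hpq
      have hp' : p ∈ X ∧ side (τ p) = b := hp
      have hq' : q ∈ X ∧ side (τ q) = b := hq
      simp only [dif_pos hp', dif_pos hq'] at hpq
      exact congrArg Subtype.val (hf hpq)
    · intro p hp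
      have hp' : p ∈ X ∧ side (τ p) = b := hp
      simp only [dif_pos hp']
      exact (Finset.mem_filter.1 (hft ⟨p, hp'⟩)).2
  obtain ⟨f, hf, hfr⟩ := hall true
  obtain ⟨g, hg, hgr⟩ := hall false
  obtain ⟨M, hMr, hM1, hM2, hMX, hMY⟩ := exists_matching_covering_both
    (r := fun p q => side (τ p) = true ∧ side (τ q) = false ∧ r (τ p) (τ q)) hf
    (fun p hp => ⟨hp.2, by
      have := hside _ _ (hfr p hp)
      rw [hp.2] at this
      simpa using this.symm, hfr p hp⟩) hg
    (fun p hp => ⟨by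
      have := hside _ _ (hgr p hp)
      rw [hp.2] at this
      simpa using this.symm, hp.2, hsymm _ _ (hgr p hp)⟩)
  have hcov : ∀ p ∈ X, ∃ q, M p q ∨ M q p := by
    intro p hp
    cases hb : side (τ p)
    · obtain ⟨q, hq⟩ := hMY p ⟨hp, hb⟩
      exact ⟨q, Or.inr hq⟩
    · obtain ⟨q, hq⟩ := hMX p ⟨hp, hb⟩
      exact ⟨q, Or.inl hq⟩
  obtain ⟨N, hN⟩ : ∃ N : P → P → Prop, ∀ p q, N p q ↔ M p q ∨ M q p := ⟨_, fun _ _ => Iff.rfl⟩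
  simp only [← hN] at hcov
  refine ⟨N, fun p q => by simpa only [hN] using Or.symm, ?_, ?_, ?_⟩
  · intro p q q' h1 h2
    rw [hN] at h1 h2
    rcases h1 with h1 | h1 <;> rcases h2 with h2 | h2
    · exact hM1 _ _ _ h1 h2
    · have e := (hMr _ _ h1).1
      rw [(hMr _ _ h2).2.1] at e
      cases e
    · have e := (hMr _ _ h2).1
      rw [(hMr _ _ h1).2.1] at e
      cases e
    · exact hM2 _ _ _ h1 h2
  · intro p q h1
    rcases (hN p q).1 h1 with h1 | h1
    · exact (hMr _ _ h1).2.2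
    · exact hsymm _ _ (hMr _ _ h1).2.2
  · intro p
    rcases hs (τ p) with hall' | hcard
    · exact Or.inl (hcov p (Finset.mem_biUnion.2 ⟨τ p, Finset.mem_univ _, hall' p rfl⟩))
    · right
      -- `B` points of type `τ p` are matched, and `B` exceeds `m` times the number of types.
      have hmem : ∀ q ∈ s (τ p), q ∈ X := fun q hq =>
        Finset.mem_biUnion.2 ⟨τ p, Finset.mem_univ _, hq⟩
      choose! π hπ using hcov
      obtain ⟨b, -, hb⟩ := Finset.exists_lt_card_fiber_of_mul_lt_card_of_maps_to
        (s := s (τ p)) (t := Finset.univ) (f := fun q => τ (π q)) (n := m)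
        (fun _ _ => Finset.mem_univ _) (by rw [hcard, Finset.card_univ, hB, mul_comm]; omega)
      refine ⟨b, lt_of_lt_of_le hb (Finset.card_le_card fun q hq => ?_)⟩
      rw [Finset.mem_filter] at hq
      exact Finset.mem_filter.2 ⟨Finset.mem_univ _, hsτ _ q hq.1, π q, hπ q (hmem q hq.1), hq.2⟩

/-! ### Weights of half-edges and Hall violators -/

/-- The weight vectors `y`, `z` of the two halves of an edge fit together. -/
def Fits {k : ℕ} (y z : Fin k → Fin 3) : Prop :=
  ∀ c, (y c : ℕ) + (z c : ℕ) ≤ 2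

theorem Fits.symm {k : ℕ} {y z : Fin k → Fin 3} (h : Fits y z) : Fits z y := fun c => by
  rw [add_comm]
  exact h c

theorem Fits.eq_zero {k : ℕ} {y z : Fin k → Fin 3} (h : Fits y z) {c : Fin k} (hy : y c = 2) :
    z c = 0 := by
  have := h c
  rw [hy] at this
  exact Fin.ext (by simpa using this)

/-- What a node knows about one of its ports: the orientation of the edge, and the weight vectors
that its half of the edge may turn out to have. -/
abbrev PortType (k : ℕ) : Type :=
  Bool × Set (Fin k → Fin 3)

/-- Ports of these types may be the two ends of an edge. -/
def Linked {k : ℕ} (a b : PortType k) : Prop :=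
  a.1 ≠ b.1 ∧ ∃ y ∈ a.2, ∃ z ∈ b.2, Fits y z

theorem Linked.symm {k : ℕ} {a b : PortType k} (h : Linked a b) : Linked b a := by
  obtain ⟨h, y, hy, z, hz, hf⟩ := h
  exact ⟨h.symm, z, hz, y, hy, hf.symm⟩

open Classical in
/-- The set `D` of port types, all of one orientation, violates Hall's condition on the ports `p` of
types `τ p`, with at most `K` neighbors. -/
def IsViolator {k : ℕ} {P : Type*} [Fintype P] (K : ℕ) (τ : P → PortType k)
    (D : Set (PortType k)) : Prop :=
  (∃ b, ∀ a ∈ D, a.1 = b) ∧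
    (Finset.univ.filter fun p => ∃ a ∈ D, Linked a (τ p)).card <
      min (K + 1) (Finset.univ.filter fun p => τ p ∈ D).card

open Classical in
/-- If all selections of weight vectors satisfy the weighted node constraint, then there is a Hall
violator: otherwise a matching of the ports yields a selection where each weight `2` at a color is
balanced by a weight `0` at the matched port, or by `k + 1` weights `0`. -/
theorem exists_isViolator {k : ℕ} {P : Type*} [Fintype P] (K : ℕ) (τ : P → PortType k)
    (hK : (k * Fintype.card (PortType k) + 1) * Fintype.card (PortType k) ≤ K + 1)
    (hnode : ∀ y : P → Fin k → Fin 3, (∀ p, y p ∈ (τ p).2) →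
      ∃ c, (Finset.univ.filter fun p => y p c = 0).card <
        min (k + 1) (Finset.univ.filter fun p => y p c = 2).card) :
    ∃ D, IsViolator K τ D := by
  by_contra hno
  obtain ⟨M, hMs, hMf, hMr, hMc⟩ := exists_matching_of_forall_not_violating τ
    (fun a : PortType k => a.1) Linked (fun _ _ h => h.symm) (fun _ _ h => h.1) k K hK
    (fun D hD hlt => hno ⟨D, hD, hlt⟩)
  -- For linked types `a`, `b`, the vectors `Y a b` of `a` and `Y b a` of `b` fit together.
  obtain ⟨Y, hY⟩ : ∃ Y : PortType k → PortType k → Fin k → Fin 3,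
      ∀ a b, Linked a b → Y a b ∈ a.2 ∧ Fits (Y a b) (Y b a) := by
    have : ∀ a b : PortType k, ∃ y z, Linked a b → y ∈ a.2 ∧ z ∈ b.2 ∧ Fits y z := by
      intro a b
      by_cases h : Linked a b
      · obtain ⟨-, y, hy, z, hz, hf⟩ := h
        exact ⟨y, z, fun _ => ⟨hy, hz, hf⟩⟩
      · exact ⟨0, 0, fun h' => absurd h' h⟩
    choose y z hyz using this
    refine ⟨fun a b => if a.1 then y a b else z b a, fun a b h => ?_⟩
    have hne := h.1
    cases ha : a.1 <;> cases hb : b.1 <;> simp only [ha, hb, ne_eq, not_true_eq_false] at hne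
    · simpa [ha, hb] using ⟨(hyz b a h.symm).2.1, (hyz b a h.symm).2.2.symm⟩
    · simpa [ha, hb] using ⟨(hyz a b h).1, (hyz a b h).2.2⟩
  have hs : ∀ p, ∃ b, (∃ q, M p q ∧ τ q = b) ∨ ((¬ ∃ q, M p q) ∧
      k < (Finset.univ.filter fun p' => τ p' = τ p ∧ ∃ q, M p' q ∧ τ q = b).card) := by
    intro p
    by_cases hp : ∃ q, M p q
    · obtain ⟨q, hq⟩ := hp
      exact ⟨τ q, Or.inl ⟨q, hq, rfl⟩⟩
    · obtain ⟨b, hb⟩ := (hMc p).resolve_left hp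
      exact ⟨b, Or.inr ⟨hp, by convert hb⟩⟩
  choose σ hσ using hs
  have hσM : ∀ p q, M p q → σ p = τ q := by
    intro p q hpq
    rcases hσ p with ⟨q', hq', h⟩ | ⟨h, -⟩
    · rw [← h, hMf p q q' hpq hq']
    · exact absurd ⟨q, hpq⟩ h
  have hlink : ∀ p, Linked (τ p) (σ p) := by
    intro p
    rcases hσ p with ⟨q, hq, h⟩ | ⟨-, h⟩
    · rw [← h]
      exact hMr p q hq
    · obtain ⟨p', hp'⟩ := Finset.card_pos.1 (lt_of_le_of_lt (Nat.zero_le _) h)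
      obtain ⟨-, h1, q, hq, h2⟩ := Finset.mem_filter.1 hp'
      rw [← h1, ← h2]
      exact hMr p' q hq
  choose! π hπ using fun p (h : ∃ q, M p q) => h
  have hπinj : ∀ p q, (∃ q, M p q) → (∃ q', M q q') → π p = π q → p = q := by
    intro p q hp hq e
    exact hMf (π p) p q (hMs _ _ (hπ p hp)) (e ▸ hMs _ _ (hπ q hq))
  obtain ⟨c, hc⟩ := hnode (fun p => Y (τ p) (σ p)) fun p => (hY _ _ (hlink p)).1
  rw [lt_min_iff] at hc
  by_cases hun : ∃ p, Y (τ p) (σ p) c = 2 ∧ ¬ ∃ q, M p q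
  · obtain ⟨p, hp2, hpu⟩ := hun
    rcases hσ p with ⟨q, hq, -⟩ | ⟨-, hlt⟩
    · exact hpu ⟨q, hq⟩
    refine absurd hc.1 (not_lt.2 (Nat.succ_le_of_lt (lt_of_lt_of_le hlt ?_)))
    refine Finset.card_le_card_of_injOn π ?_ ?_
    · intro p' hp'
      obtain ⟨-, h1, q, hq, h2⟩ := Finset.mem_filter.1 hp'
      have hπq : π p' = q := hMf _ _ _ (hπ p' ⟨q, hq⟩) hq
      refine Finset.mem_filter.2 ⟨Finset.mem_univ _, ?_⟩
      rw [hπq, hσM q p' (hMs _ _ hq), h1, h2]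
      exact (hY _ _ (hlink p)).2.eq_zero hp2
    · intro p' hp' q' hq' e
      obtain ⟨-, -, q1, h1, -⟩ := Finset.mem_filter.1 hp'
      obtain ⟨-, -, q2, h2, -⟩ := Finset.mem_filter.1 hq'
      exact hπinj p' q' ⟨q1, h1⟩ ⟨q2, h2⟩ e
  · push Not at hun
    refine absurd hc.2 (not_lt.2 (Finset.card_le_card_of_injOn π ?_ ?_))
    · intro p hp
      have hp2 := (Finset.mem_filter.1 hp).2
      have hM := hπ p (hun p hp2)
      refine Finset.mem_filter.2 ⟨Finset.mem_univ _, ?_⟩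
      rw [hσM _ _ (hMs _ _ hM), ← hσM _ _ hM]
      exact (hY _ _ (hlink p)).2.eq_zero hp2
    · intro p hp q hq e
      exact hπinj p q (hun p (Finset.mem_filter.1 hp).2) (hun q (Finset.mem_filter.1 hq).2) e

/-! ### Numbers of port types and of colors -/

theorem card_portType (k : ℕ) : Fintype.card (PortType k) = 2 ^ (3 ^ k + 1) := by
  simp [PortType, pow_succ, mul_comm]

theorem add_three_pow_le_five_pow {k : ℕ} (hk : 2 ≤ k) : k + 2 * 3 ^ k + 2 ≤ 5 ^ k := by
  induction k, hk using Nat.le_induction with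
  | base => norm_num
  | succ k hk ih =>
    have := Nat.pow_le_pow_left (show 3 ≤ 5 by norm_num) k
    rw [pow_succ, pow_succ]
    omega

theorem mul_card_portType_le {k : ℕ} (hk : 2 ≤ k) :
    (k * Fintype.card (PortType k) + 1) * Fintype.card (PortType k) ≤ 2 ^ (2 ^ (5 ^ k)) + 1 := by
  rw [card_portType]
  set T := 2 ^ (3 ^ k + 1) with hT
  have hT1 : 1 ≤ T := Nat.one_le_two_pow
  have h1 : k + 1 ≤ 2 ^ k := Nat.lt_two_pow_self
  calc (k * T + 1) * T ≤ (k * T + T) * T := by gcongr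
    _ = (k + 1) * (T * T) := by ring
    _ ≤ 2 ^ k * (T * T) := by gcongr
    _ = 2 ^ (k + 2 * 3 ^ k + 2) := by rw [hT]; ring
    _ ≤ 2 ^ (2 ^ (5 ^ k)) := Nat.pow_le_pow_right (by norm_num)
        ((add_three_pow_le_five_pow hk).trans Nat.lt_two_pow_self.le)
    _ ≤ _ := Nat.le_succ _

theorem exists_injective_color {k : ℕ} (hk : 2 ≤ k) :
    ∃ f : Set (PortType k) → Fin (2 ^ (2 ^ (5 ^ k))), Function.Injective f := by
  have : Fintype.card (Set (PortType k)) ≤ Fintype.card (Fin (2 ^ (2 ^ (5 ^ k)))) := by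
    rw [Fintype.card_set, card_portType, Fintype.card_fin]
    refine Nat.pow_le_pow_right (by norm_num) (Nat.pow_le_pow_right (by norm_num) ?_)
    have := add_three_pow_le_five_pow hk
    omega
  obtain ⟨f⟩ := Function.Embedding.nonempty_of_card_le this
  exact ⟨f, f.injective⟩

/-! ### Merging orders of identifiers -/

theorem exists_forall_mem_lt_iff {V L M : Type*} [Fintype V] [LinearOrder L] [LinearOrder M]
    {f : V → L} (hf : Function.Injective f) (S : Finset M) (hS : Fintype.card V ≤ S.card) :
    ∃ g : V → M, (∀ x, g x ∈ S) ∧ ∀ x y, g x < g y ↔ f x < f y := by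
  let _ : LinearOrder V := LinearOrder.lift' f hf
  let e := Fintype.orderIsoFinOfCardEq V rfl
  refine ⟨fun x => S.orderEmbOfFin rfl (Fin.castLE hS (e.symm x)), fun x => ?_, fun x y => ?_⟩
  · exact Finset.orderEmbOfFin_mem _ _ _
  · rw [OrderEmbedding.lt_iff_lt, Fin.castLE_lt_castLE_iff, OrderIso.lt_iff_lt]
    rfl

open Classical in
/-- Linear orders on sets that pairwise meet in a common core, on which the orders agree, extend to
one linear order. Here each order is given by an injective function to `L`, and the common extension
by an injective function to a large enough finite set `S`. -/
theorem exists_common_order {V ι L M : Type*} [Fintype V] [LinearOrder L] [LinearOrder M]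
    (S : Finset M) (hS : Fintype.card V ≤ S.card) {C : Set V} {A : ι → Set V}
    (hAA : ∀ i j, i ≠ j → A i ∩ A j ⊆ C) {f : ι → V → L} (hf : ∀ i, Set.InjOn (f i) (A i))
    (hC : ∀ i j, ∀ a ∈ C, ∀ b ∈ C, f i a < f i b ↔ f j a < f j b) :
    ∃ g : V → M, Function.Injective g ∧ (∀ x, g x ∈ S) ∧
      ∀ i, ∀ x ∈ A i, ∀ y ∈ A i, g x < g y ↔ f i x < f i y := by
  -- Sort by the position relative to the core, then core first, then by value.
  let R : V → ℕ := fun x => if h : ∃ i, x ∈ A i then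
    (Finset.univ.filter fun c => c ∈ C ∧ f h.choose c ≤ f h.choose x).card else 0
  let Z : V → WithBot L := fun x => if h : x ∉ C ∧ ∃ i, x ∈ A i then f h.2.choose x else ⊥
  have hR : ∀ i, ∀ x ∈ A i, R x = (Finset.univ.filter fun c => c ∈ C ∧ f i c ≤ f i x).card := by
    intro i x hx
    have h : ∃ i, x ∈ A i := ⟨i, hx⟩
    simp only [R, dif_pos h]
    by_cases hi : h.choose = i
    · rw [hi]
    · have hxC : x ∈ C := hAA _ _ hi ⟨h.choose_spec, hx⟩
      congr 1
      ext c
      simp only [Finset.mem_filter, Finset.mem_univ, true_and, and_congr_right_iff]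
      intro hc
      rw [← not_lt, ← not_lt, hC h.choose i x hxC c hc]
  have hZ : ∀ i, ∀ x ∈ A i, x ∉ C → Z x = f i x := by
    intro i x hx hxC
    have h : x ∉ C ∧ ∃ i, x ∈ A i := ⟨hxC, i, hx⟩
    simp only [Z, dif_pos h]
    have hi : h.2.choose = i := by
      by_contra hi
      exact hxC (hAA _ _ hi ⟨h.2.choose_spec, hx⟩)
    rw [hi]
  have hZC : ∀ x ∈ C, Z x = ⊥ := fun x hx => dif_neg fun h => h.1 hx
  have key : ∀ i, ∀ x ∈ A i, ∀ y ∈ A i, f i x < f i y → R x < R y ∨ R x = R y ∧ Z x < Z y := by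
    intro i x hx y hy hxy
    rw [hR i x hx, hR i y hy]
    have hsub : (Finset.univ.filter fun c => c ∈ C ∧ f i c ≤ f i x) ⊆
        Finset.univ.filter fun c => c ∈ C ∧ f i c ≤ f i y := fun c hc => by
      simp only [Finset.mem_filter, Finset.mem_univ, true_and] at hc ⊢
      exact ⟨hc.1, hc.2.trans hxy.le⟩
    by_cases hyC : y ∈ C
    · refine Or.inl (Finset.card_lt_card ((Finset.ssubset_iff_of_subset hsub).2 ⟨y, ?_, ?_⟩))
      · simp [hyC]
      · simp [hxy]
    · rcases (Finset.card_le_card hsub).lt_or_eq with h | h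
      · exact Or.inl h
      · refine Or.inr ⟨h, ?_⟩
        rw [hZ i y hy hyC]
        by_cases hxC : x ∈ C
        · rw [hZC x hxC]
          exact WithBot.bot_lt_coe _
        · rw [hZ i x hx hxC]
          exact WithBot.coe_lt_coe.2 hxy
  let e := Fintype.equivFin V
  let F : V → ℕ ×ₗ WithBot L ×ₗ Fin (Fintype.card V) := fun x => toLex (R x, toLex (Z x, e x))
  have hF : Function.Injective F := fun x y h => by
    have h1 := congrArg (fun z => (ofLex (ofLex z).2).2) h
    exact e.injective h1
  have hlt : ∀ i, ∀ x ∈ A i, ∀ y ∈ A i, f i x < f i y → F x < F y := by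
    intro i x hx y hy hxy
    rw [Prod.Lex.toLex_lt_toLex]
    refine (key i x hx y hy hxy).imp_right fun h => ⟨h.1, ?_⟩
    rw [Prod.Lex.toLex_lt_toLex]
    exact Or.inl h.2
  obtain ⟨g, hgS, hg⟩ := exists_forall_mem_lt_iff hF S hS
  refine ⟨g, fun x y h => ?_, hgS, fun i x hx y hy => ?_⟩
  · by_contra hne
    rcases lt_or_gt_of_ne (hF.ne hne) with h' | h'
    · exact absurd h ((hg _ _).2 h').ne
    · exact absurd h ((hg _ _).2 h').ne'
  · rw [hg]
    refine ⟨fun h => ?_, hlt i x hx y hy⟩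
    by_contra h'
    rcases (not_lt.1 h').lt_or_eq with h'' | h''
    · exact absurd h (hlt i y hy x hx h'').not_gt
    · rw [hf i hy hx h''] at h
      exact lt_irrefl _ h

/-- Views `X i` with identifiers `ident i`, which all contain a copy of a core view with the same
order of identifiers, are embedded by `ψ i` into a graph where their images only overlap in the
core. Then that graph has identifiers that induce the given order on each of the views. -/
theorem exists_common_ident {n : ℕ} {ι : Type*} (S : Finset ℕ+) (hS : n ≤ S.card)
    {X₀ C : Set (Fin n)} {X A : ι → Set (Fin n)} {id₀ : Fin n → ℕ+} {ident : ι → Fin n → ℕ+}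
    {χ : Fin n → Fin n} {φ ψ : ι → Fin n → Fin n} (hid : ∀ i, Function.Injective (ident i))
    (hχ : Set.BijOn χ X₀ C) (hφ : ∀ i, Set.MapsTo (φ i) X₀ (X i))
    (hφlt : ∀ i, ∀ a ∈ X₀, ∀ b ∈ X₀, ident i (φ i a) < ident i (φ i b) ↔ id₀ a < id₀ b)
    (hψ : ∀ i, Set.BijOn (ψ i) (X i) (A i)) (hψχ : ∀ i, Set.EqOn (ψ i ∘ φ i) χ X₀)
    (hAA : ∀ i j, i ≠ j → A i ∩ A j ⊆ C) :
    ∃ g : Fin n → ℕ+, Function.Injective g ∧ (∀ x, g x ∈ S) ∧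
      ∀ i, ∀ x ∈ X i, ∀ y ∈ X i, g (ψ i x) < g (ψ i y) ↔ ident i x < ident i y := by
  rcases Nat.eq_zero_or_pos n with rfl | hn
  · exact ⟨finZeroElim, fun x => x.elim0, fun x => x.elim0, fun _ x => x.elim0⟩
  have : Nonempty (Fin n) := ⟨⟨0, hn⟩⟩
  have hinv : ∀ i, ∀ x ∈ X i, Function.invFunOn (ψ i) (X i) (ψ i x) = x := fun i x hx =>
    (hψ i).injOn.leftInvOn_invFunOn hx
  have hcore : ∀ i, ∀ a ∈ X₀, Function.invFunOn (ψ i) (X i) (χ a) = φ i a := fun i a ha => by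
    rw [← hψχ i ha]
    exact hinv i _ (hφ i ha)
  obtain ⟨g, hg, hgS, hlt⟩ := exists_common_order (V := Fin n) S (by simpa using hS) (C := C)
    (A := A) (f := fun i x => ident i (Function.invFunOn (ψ i) (X i) x)) hAA
    (fun i x hx y hy h => by
      obtain ⟨a, ha, rfl⟩ := (hψ i).surjOn hx
      obtain ⟨b, hb, rfl⟩ := (hψ i).surjOn hy
      have := hid i h
      rw [hinv i a ha, hinv i b hb] at this
      rw [this])
    (fun i j x hx y hy => by
      obtain ⟨a, ha, rfl⟩ := hχ.surjOn hx
      obtain ⟨b, hb, rfl⟩ := hχ.surjOn hy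
      simp only [hcore _ _ ha, hcore _ _ hb, hφlt _ _ ha _ hb])
  refine ⟨g, hg, hgS, fun i x hx y hy => ?_⟩
  rw [hlt i _ ((hψ i).mapsTo hx) _ ((hψ i).mapsTo hy)]
  simp only [hinv i x hx, hinv i y hy]

/-! ### Overlaps of neighborhoods under a girth bound -/

/-- If `x` and two of its neighbors are at distance at most `t` from `z`, then `x` is even closer to
`z`: otherwise two paths from `x` to `z` close up to a cycle of length at most `2 * t + 1`. -/
theorem dist_lt_of_two_neighbors {V : Type*} {G : SimpleGraph V} (hconn : G.Connected) {t : ℕ}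
    (hgirth : ((2 * t + 2 : ℕ) : ℕ∞) ≤ G.egirth) {x a b z : V} (ha : G.Adj x a) (hb : G.Adj x b)
    (hab : a ≠ b) (hx : G.dist x z ≤ t) (haz : G.dist a z ≤ t) (hbz : G.dist b z ≤ t) :
    G.dist x z < t := by
  classical
  by_contra hlt
  have hxt : G.dist x z = t := le_antisymm hx (not_lt.1 hlt)
  obtain ⟨p, hp, hpl⟩ := hconn.exists_path_of_dist x z
  have key : ∀ c, G.Adj x c → G.dist c z ≤ t → p.snd = c := by
    intro c hc hcz
    obtain ⟨q, hq, hql⟩ := hconn.exists_path_of_dist c z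
    have hxq : x ∉ q.support := by
      intro hmem
      have h1 := congrArg SimpleGraph.Walk.length (q.take_spec hmem)
      rw [SimpleGraph.Walk.length_append] at h1
      have h2 := SimpleGraph.dist_le (q.dropUntil x hmem)
      have h3 : (q.takeUntil x hmem).length ≠ 0 := fun h0 =>
        hc.ne' (SimpleGraph.Walk.eq_of_length_eq_zero h0)
      omega
    have hq' : (SimpleGraph.Walk.cons hc q).IsPath := hq.cons hxq
    have heq : p = SimpleGraph.Walk.cons hc q := by
      by_contra hne
      obtain ⟨w, c', hc', hle⟩ : ∃ (w : V) (c : G.Walk w w), c.IsCycle ∧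
          c.length ≤ p.length + (SimpleGraph.Walk.cons hc q).length := by
        obtain ⟨w, _, _, c, h1, h2⟩ := hp.exists_isCycle_length_le_add_of_ne hq' hne
        exact ⟨w, c, h1, h2⟩
      have h1 := hgirth.trans (SimpleGraph.egirth_le_length hc')
      rw [Nat.cast_le] at h1
      rw [SimpleGraph.Walk.length_cons] at hle
      omega
    rw [heq]
    simp
  exact hab ((key a ha haz).symm.trans (key b hb hbz))

/-! ### Views with ordered identifiers -/

theorem PortedGraph.adj_nbr {n Δ : ℕ} {Λ : Type*} (P : PortedGraph n Δ Λ) (v : Fin n) (i : Fin Δ) :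
    P.graph.Adj v (P.nbr v i) :=
  (P.port v i).2

theorem PortedGraph.nbr_injective {n Δ : ℕ} {Λ : Type*} (P : PortedGraph n Δ Λ) (v : Fin n) :
    Function.Injective (P.nbr v) :=
  fun _ _ h => (P.port v).injective (Subtype.ext h)

theorem PortedGraph.mem_nodeNbhd_self {n Δ : ℕ} {Λ : Type*} (P : PortedGraph n Δ Λ) (t : ℕ)
    (v : Fin n) : v ∈ P.nodeNbhd t v := by
  simp [PortedGraph.nodeNbhd]

theorem PortedGraph.dist_le_of_adj {n Δ : ℕ} {Λ : Type*} (P : PortedGraph n Δ Λ) {u v : Fin n}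
    (h : P.graph.Adj u v) (x : Fin n) : P.graph.dist v x ≤ P.graph.dist u x + 1 := by
  have h1 := P.connected.dist_triangle (u := v) (v := u) (w := x)
  rw [SimpleGraph.dist_eq_one_iff_adj.2 h.symm] at h1
  omega

theorem PortedGraph.nodeNbhd_subset_edgeNbhd {n Δ : ℕ} {Λ : Type*} (P : PortedGraph n Δ Λ) {t : ℕ}
    (ht : 1 ≤ t) {u v : Fin n} (h : P.graph.Adj u v) :
    P.nodeNbhd (t - 1) u ⊆ P.edgeNbhd t u v := by
  intro x hx
  have h1 : P.graph.dist u x ≤ t - 1 := hx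
  have h2 := P.dist_le_of_adj h x
  exact ⟨show P.graph.dist u x ≤ t by omega, show P.graph.dist v x ≤ t by omega⟩

theorem PortedGraph.left_mem_edgeNbhd {n Δ : ℕ} {Λ : Type*} (P : PortedGraph n Δ Λ) {t : ℕ}
    (ht : 1 ≤ t) {u v : Fin n} (h : P.graph.Adj u v) : u ∈ P.edgeNbhd t u v :=
  P.nodeNbhd_subset_edgeNbhd ht h (P.mem_nodeNbhd_self _ u)

theorem PortedGraph.edgeNbhd_comm {n Δ : ℕ} {Λ : Type*} (P : PortedGraph n Δ Λ) (t : ℕ)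
    (u v : Fin n) : P.edgeNbhd t u v = P.edgeNbhd t v u :=
  Set.inter_comm _ _

theorem PortedGraph.right_mem_edgeNbhd {n Δ : ℕ} {Λ : Type*} (P : PortedGraph n Δ Λ) {t : ℕ}
    (ht : 1 ≤ t) {u v : Fin n} (h : P.graph.Adj u v) : v ∈ P.edgeNbhd t u v :=
  P.edgeNbhd_comm t v u ▸ P.left_mem_edgeNbhd ht h.symm

theorem PortedGraph.edgeNbhd_inter_subset {n Δ : ℕ} {Λ : Type*} (P : PortedGraph n Δ Λ) {t : ℕ}
    (hgirth : ((2 * t + 2 : ℕ) : ℕ∞) ≤ P.graph.egirth) (x : Fin n) {i j : Fin Δ} (hij : i ≠ j) :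
    P.edgeNbhd t x (P.nbr x i) ∩ P.edgeNbhd t x (P.nbr x j) ⊆ P.nodeNbhd (t - 1) x := by
  rintro z ⟨⟨hx, hi⟩, -, hj⟩
  exact Nat.le_sub_one_of_lt (dist_lt_of_two_neighbors P.connected hgirth (P.adj_nbr x i)
    (P.adj_nbr x j) ((P.nbr_injective x).ne hij) hx hi hj)

/-- `φ` is an isomorphism from the information that `I` holds on `X` to the information that `J`
holds on `Y`, where only the relative order of the identifiers counts. -/
structure IsOrderIso {n Δ : ℕ} {Λ : Type*} (I J : Network n Δ Λ) (X Y : Set (Fin n))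
    (φ : Fin n → Fin n) : Prop extends
    PortedGraph.IsIso I.toPortedGraph J.toPortedGraph X Y φ where
  lt_iff : ∀ x ∈ X, ∀ y ∈ X, J.ident (φ x) < J.ident (φ y) ↔ I.ident x < I.ident y

section IsOrderIso

variable {n Δ : ℕ} {Λ : Type*} {I J K : Network n Δ Λ} {X Y Z : Set (Fin n)} {φ ψ : Fin n → Fin n}

theorem IsOrderIso.id (I : Network n Δ Λ) (X : Set (Fin n)) : IsOrderIso I I X X id where
  bijOn := Set.bijOn_id X
  label_eq _ _ _ := rfl
  nbr_iff _ _ _ _ _ := Iff.rfl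
  lt_iff _ _ _ _ := Iff.rfl

theorem IsOrderIso.comp (hψ : IsOrderIso J K Y Z ψ) (hφ : IsOrderIso I J X Y φ) :
    IsOrderIso I K X Z (ψ ∘ φ) where
  bijOn := hψ.bijOn.comp hφ.bijOn
  label_eq x hx i := (hψ.label_eq _ (hφ.bijOn.mapsTo hx) i).trans (hφ.label_eq x hx i)
  nbr_iff x hx y hy i := (hφ.nbr_iff x hx y hy i).trans
    (hψ.nbr_iff _ (hφ.bijOn.mapsTo hx) _ (hφ.bijOn.mapsTo hy) i)
  lt_iff x hx y hy := (hψ.lt_iff _ (hφ.bijOn.mapsTo hx) _ (hφ.bijOn.mapsTo hy)).trans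
    (hφ.lt_iff x hx y hy)

theorem IsOrderIso.exists_symm (h : IsOrderIso I J X Y φ) :
    ∃ ψ, IsOrderIso J I Y X ψ ∧ ∀ x ∈ X, ψ (φ x) = x := by
  have : Nonempty (Fin n) := I.connected.nonempty
  have hinv : ∀ x ∈ X, Function.invFunOn φ X (φ x) = x := fun x hx =>
    h.bijOn.injOn.leftInvOn_invFunOn hx
  refine ⟨Function.invFunOn φ X, ⟨⟨?_, ?_, ?_⟩, ?_⟩, hinv⟩
  · exact h.bijOn.symm h.bijOn.invOn_invFunOn.symm
  · intro y hy i
    obtain ⟨x, hx, rfl⟩ := h.bijOn.surjOn hy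
    rw [hinv x hx, h.label_eq x hx i]
  · intro y hy y' hy' i
    obtain ⟨x, hx, rfl⟩ := h.bijOn.surjOn hy
    obtain ⟨x', hx', rfl⟩ := h.bijOn.surjOn hy'
    rw [hinv x hx, hinv x' hx', h.nbr_iff x hx x' hx' i]
  · intro y hy y' hy'
    obtain ⟨x, hx, rfl⟩ := h.bijOn.surjOn hy
    obtain ⟨x', hx', rfl⟩ := h.bijOn.surjOn hy'
    rw [hinv x hx, hinv x' hx', h.lt_iff x hx x' hx']

end IsOrderIso

/-- The radius-`t` neighborhoods of `v` in `I` and of `w` in `J` are isomorphic, where only the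
relative order of the identifiers counts. -/
def NodeSim {n Δ : ℕ} {Λ : Type*} (t : ℕ) (I : Network n Δ Λ) (v : Fin n) (J : Network n Δ Λ)
    (w : Fin n) : Prop :=
  ∃ φ, φ v = w ∧ IsOrderIso I J (I.nodeNbhd t v) (J.nodeNbhd t w) φ

/-- The radius-`t` neighborhoods of the edges at port `i` of `v` in `I` and at port `i` of `w` in
`J` are isomorphic, with `v` corresponding to `w`, where only the relative order of the identifiers
counts. -/
def EdgeSim {n Δ : ℕ} {Λ : Type*} (t : ℕ) (i : Fin Δ) (I : Network n Δ Λ) (v : Fin n)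
    (J : Network n Δ Λ) (w : Fin n) : Prop :=
  ∃ φ, φ v = w ∧ φ (I.nbr v i) = J.nbr w i ∧
    IsOrderIso I J (I.edgeNbhd t v (I.nbr v i)) (J.edgeNbhd t w (J.nbr w i)) φ

section Sim

variable {n Δ : ℕ} {Λ : Type*} {t : ℕ} {i : Fin Δ} {I J K : Network n Δ Λ} {u v w : Fin n}

theorem NodeSim.refl (t : ℕ) (I : Network n Δ Λ) (v : Fin n) : NodeSim t I v I v :=
  ⟨id, rfl, .id _ _⟩

theorem NodeSim.symm (h : NodeSim t I v J w) : NodeSim t J w I v := by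
  obtain ⟨φ, rfl, h⟩ := h
  obtain ⟨ψ, hψ, hinv⟩ := h.exists_symm
  exact ⟨ψ, hinv v (I.mem_nodeNbhd_self t v), hψ⟩

theorem NodeSim.trans (h : NodeSim t I u J v) (h' : NodeSim t J v K w) : NodeSim t I u K w := by
  obtain ⟨φ, rfl, h⟩ := h
  obtain ⟨ψ, rfl, h'⟩ := h'
  exact ⟨ψ ∘ φ, rfl, h'.comp h⟩

theorem EdgeSim.refl (t : ℕ) (i : Fin Δ) (I : Network n Δ Λ) (v : Fin n) : EdgeSim t i I v I v :=
  ⟨id, rfl, rfl, .id _ _⟩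

theorem EdgeSim.symm (ht : 1 ≤ t) (h : EdgeSim t i I v J w) : EdgeSim t i J w I v := by
  obtain ⟨φ, rfl, h1, h⟩ := h
  obtain ⟨ψ, hψ, hinv⟩ := h.exists_symm
  exact ⟨ψ, hinv v (I.left_mem_edgeNbhd ht (I.adj_nbr v i)),
    h1 ▸ hinv _ (I.right_mem_edgeNbhd ht (I.adj_nbr v i)), hψ⟩

theorem EdgeSim.trans (h : EdgeSim t i I u J v) (h' : EdgeSim t i J v K w) :
    EdgeSim t i I u K w := by
  obtain ⟨φ, rfl, h1, h⟩ := h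
  obtain ⟨ψ, rfl, h1', h'⟩ := h'
  exact ⟨ψ ∘ φ, rfl, by rw [Function.comp_apply, h1, h1'], h'.comp h⟩

theorem card_le_of_mem_withIdents {𝒢 : Set (LabeledGraph n Λ)} {S : Finset ℕ+}
    (hI : I ∈ withIdents Δ 𝒢 S) : n ≤ S.card := by
  have := Finset.card_le_card_of_injOn (s := Finset.univ) (t := S) I.ident
    (fun v _ => hI.2.2 v) (hI.2.1.injOn)
  simpa using this

/-! ### Outputs that an edge or a node can foresee -/

/-- The outputs of `A` at port `i` of `v` that are possible given the radius-`t` neighborhood of the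
edge at this port, up to the order of identifiers. -/
def halfOutputs {O : Type*} (A : Algorithm n Δ Λ O) (𝒩 : Set (Network n Δ Λ)) (t : ℕ)
    (I : Network n Δ Λ) (v : Fin n) (i : Fin Δ) : Set O :=
  {o | ∃ J ∈ 𝒩, ∃ w, EdgeSim t i I v J w ∧ A J w i = o}

theorem halfOutputs_congr {O : Type*} (A : Algorithm n Δ Λ O) (𝒩 : Set (Network n Δ Λ))
    (ht : 1 ≤ t) (h : EdgeSim t i I v J w) : halfOutputs A 𝒩 t I v i = halfOutputs A 𝒩 t J w i := by
  ext o
  constructor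
  · rintro ⟨K, hK, x, hx, rfl⟩
    exact ⟨K, hK, x, (h.symm ht).trans hx, rfl⟩
  · rintro ⟨K, hK, x, hx, rfl⟩
    exact ⟨K, hK, x, h.trans hx, rfl⟩

variable {O : Type*} {prob : Problem O} {𝒢 : Set (LabeledGraph n Λ)} {S : Finset ℕ+}
  {A : Algorithm n Δ Λ O}

/-- Any two outputs that are possible at the two halves of an edge occur together at an edge of one
network of the class, by independence at edges. -/
theorem mem_edge_of_mem_halfOutputs (ht : 1 ≤ t) (hindep : EdgeIndependent Δ 𝒢 t)
    (hA : IsOrderInvariant A (withIdents Δ 𝒢 S) t) (hsol : Solves A (withIdents Δ 𝒢 S) prob)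
    (hI : I ∈ withIdents Δ 𝒢 S) {j : Fin Δ} (hj : I.nbr (I.nbr v i) j = v) {o o' : O}
    (ho : o ∈ halfOutputs A (withIdents Δ 𝒢 S) t I v i)
    (ho' : o' ∈ halfOutputs A (withIdents Δ 𝒢 S) t I (I.nbr v i) j) : s(o, o') ∈ prob.edge := by
  obtain ⟨J₁, hJ₁, w₁, ⟨φ₁, rfl, h₁, hφ₁⟩, rfl⟩ := ho
  obtain ⟨J₂, hJ₂, w₂, ⟨φ₂, rfl, h₂, hφ₂⟩, rfl⟩ := ho'
  set u := I.nbr v i with hu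
  rw [hj] at h₂ hφ₂
  rw [← h₁] at hφ₁
  rw [← h₂, PortedGraph.edgeNbhd_comm, PortedGraph.edgeNbhd_comm J₂.toPortedGraph] at hφ₂
  have hadj₁ : J₁.graph.Adj (φ₁ v) (φ₁ u) := h₁ ▸ J₁.adj_nbr _ _
  have hadj₂ : J₂.graph.Adj (φ₂ v) (φ₂ u) := h₂ ▸ (J₂.adj_nbr _ _).symm
  obtain ⟨H, hH, v', u', hadj, χ, ⟨hχv, hχu, hχ⟩, ⟨ψ₂, ⟨hψu, hψ₂⟩, he₂⟩, ψ₁, ⟨hψv, hψ₁⟩, he₁⟩ :=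
    hindep I.toPortedGraph hI.1 v u (I.adj_nbr v i)
      J₂.toPortedGraph hJ₂.1 (φ₂ v) (φ₂ u) hadj₂ φ₂ ⟨rfl, rfl, hφ₂.toIsIso⟩
      J₁.toPortedGraph hJ₁.1 (φ₁ v) (φ₁ u) hadj₁ φ₁ ⟨rfl, rfl, hφ₁.toIsIso⟩
  have hn := card_le_of_mem_withIdents hI
  -- The identifiers seen by `v'` are ordered as in `J₁`, and those seen by `u'` as in `J₂`.
  obtain ⟨g, hg, hgS, hlt⟩ := exists_common_ident (ι := Bool) S hn
    (X₀ := I.edgeNbhd t v u) (C := H.edgeNbhd t v' u')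
    (X := fun b => cond b (J₁.nodeNbhd t (φ₁ v)) (J₂.nodeNbhd t (φ₂ u)))
    (A := fun b => cond b (H.nodeNbhd t v') (H.nodeNbhd t u')) (id₀ := I.ident)
    (ident := fun b => cond b J₁.ident J₂.ident) (χ := χ) (φ := fun b => cond b φ₁ φ₂)
    (ψ := fun b => cond b ψ₁ ψ₂) (by rintro (_ | _); exacts [hJ₂.2.1, hJ₁.2.1]) hχ.bijOn
    (by
      rintro (_ | _) x hx
      exacts [(hφ₂.bijOn.mapsTo hx).2, (hφ₁.bijOn.mapsTo hx).1])
    (by rintro (_ | _); exacts [hφ₂.lt_iff, hφ₁.lt_iff])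
    (by rintro (_ | _); exacts [hψ₂.bijOn, hψ₁.bijOn])
    (by rintro (_ | _); exacts [he₂, he₁])
    (by
      rintro (_ | _) (_ | _) hne
      exacts [absurd rfl hne, fun x hx => ⟨hx.2, hx.1⟩, fun x hx => hx, absurd rfl hne])
  let N : Network n Δ Λ := { toPortedGraph := H, ident := g }
  have hN : N ∈ withIdents Δ 𝒢 S := ⟨hH, hg, hgS⟩
  have hv := I.left_mem_edgeNbhd ht (I.adj_nbr v i)
  have hu' := I.right_mem_edgeNbhd ht (I.adj_nbr v i)
  have hi : N.nbr v' i = u' := by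
    have := (hχ.nbr_iff v hv u hu' i).1 rfl
    rwa [hχv, hχu] at this
  have hj' : N.nbr u' j = v' := by
    have := (hχ.nbr_iff u hu' v hv j).1 hj
    rwa [hχv, hχu] at this
  have e₁ : A J₁ (φ₁ v) = A N v' :=
    hA J₁ hJ₁ N hN _ _ ψ₁ ⟨hψv, hψ₁⟩ (hlt true)
  have e₂ : A J₂ (φ₂ u) = A N u' :=
    hA J₂ hJ₂ N hN _ _ ψ₂ ⟨hψu, hψ₂⟩ (hlt false)
  rw [e₁, e₂, ← hi]
  exact (hsol N hN).2 v' i j (by rw [hi, hj'])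

/-- If, for each port `i`, the radius-`t - 1` neighborhood of `v` is also the one of `w i` in the
network `J i`, then some node of one network of the class has the same possible outputs at each port
`i` as `w i`, by independence at nodes. -/
theorem exists_halfOutputs_eq (ht : 1 ≤ t) (hindep : NodeIndependent Δ 𝒢 t)
    (hgirth : ∀ G ∈ 𝒢, ((2 * t + 2 : ℕ) : ℕ∞) ≤ G.graph.egirth)
    (hI : I ∈ withIdents Δ 𝒢 S) {J : Fin Δ → Network n Δ Λ} {w : Fin Δ → Fin n}
    (hJ : ∀ i, J i ∈ withIdents Δ 𝒢 S) (hsim : ∀ i, NodeSim (t - 1) I v (J i) (w i)) :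
    ∃ K ∈ withIdents Δ 𝒢 S, ∃ x, ∀ i, halfOutputs A (withIdents Δ 𝒢 S) t K x i =
      halfOutputs A (withIdents Δ 𝒢 S) t (J i) (w i) i := by
  choose φ hφv hφ using hsim
  obtain ⟨H, hH, x, χ, ⟨hχv, hχ⟩, hψ⟩ := hindep I.toPortedGraph hI.1 v
    (fun i => (J i).toPortedGraph) (fun i => (hJ i).1) w φ (fun i => ⟨hφv i, (hφ i).toIsIso⟩)
  choose ψ hψ he using hψ
  -- The girth bound makes the neighborhoods of the edges at `x` overlap in the core only.
  obtain ⟨g, hg, hgS, hlt⟩ := exists_common_ident S (card_le_of_mem_withIdents hI)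
    (X₀ := I.nodeNbhd (t - 1) v) (C := H.nodeNbhd (t - 1) x)
    (X := fun i => (J i).edgeNbhd t (w i) ((J i).nbr (w i) i))
    (A := fun i => H.edgeNbhd t x (H.nbr x i)) (id₀ := I.ident)
    (ident := fun i => (J i).ident) (φ := φ) (ψ := ψ) (fun i => (hJ i).2.1) hχ.bijOn
    (fun i => (hφ i).bijOn.mapsTo.mono_right
      ((J i).nodeNbhd_subset_edgeNbhd ht ((J i).adj_nbr _ _)))
    (fun i => (hφ i).lt_iff) (fun i => (hψ i).2.2.bijOn) he
    (fun i j hij => H.edgeNbhd_inter_subset (hgirth _ hH) x hij)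
  let N : Network n Δ Λ := { toPortedGraph := H, ident := g }
  refine ⟨N, ⟨hH, hg, hgS⟩, x, fun i => (halfOutputs_congr A _ ht ?_).symm⟩
  exact ⟨ψ i, (hψ i).1, (hψ i).2.1, (hψ i).2.2, hlt i⟩

end Sim

/-! ### Weights of sets of outputs -/

open Classical in
/-- The largest weight of the outputs of each color in the set `Y`, where the weights of
`accepting`, `none`, `demanding` are `0`, `1`, `2`. Only these maxima matter at an edge: two
pointers of the same color are allowed there if and only if their weights sum to at most `2`. -/
noncomputable def weights {k : ℕ} (Y : Set (Fin k × Pointer)) (c : Fin k) : Fin 3 :=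
  if (c, Pointer.demanding) ∈ Y then 2 else if (c, Pointer.none) ∈ Y then 1 else 0

theorem countP_map_univ {α β : Type*} [Fintype α] (f : α → β) (p : β → Prop) [DecidablePred p] :
    ((Finset.univ : Finset α).val.map f).countP p =
      (Finset.univ.filter fun a => p (f a)).card := by
  rw [Multiset.countP_map]
  rfl

theorem mk_mem_superweakColoring_edge {k Δ : ℕ} {c : Fin k} {p q : Pointer}
    (h : s((c, p), (c, q)) ∈ (superweakColoring k Δ).edge) :
    (p = .none ∧ q = .none) ∨ p = .accepting ∨ q = .accepting := by
  obtain ⟨y, z, y', z', h, h'⟩ := h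
  rw [Sym2.eq_iff] at h
  simp only [Prod.mk.injEq] at h
  rcases h with ⟨⟨rfl, rfl⟩, rfl, rfl⟩ | ⟨⟨rfl, rfl⟩, rfl, rfl⟩ <;> simp at h' <;> tauto

theorem fits_weights {k Δ : ℕ} {Y Z : Set (Fin k × Pointer)}
    (h : ∀ y ∈ Y, ∀ z ∈ Z, s(y, z) ∈ (superweakColoring k Δ).edge) :
    Fits (weights Y) (weights Z) := by
  intro c
  have h' : ∀ p q, (c, p) ∈ Y → (c, q) ∈ Z → _ := fun p q hp hq =>
    mk_mem_superweakColoring_edge (h _ hp _ hq)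
  have h1 := h' .demanding .demanding
  have h2 := h' .demanding .none
  have h3 := h' .none .demanding
  simp only [reduceCtorEq, and_true, and_false, or_false, imp_false] at h1 h2 h3
  unfold weights
  split_ifs <;> simp_all

/-- A selection of outputs that satisfies the node constraint yields a color at which the weights
satisfy the same constraint: weight `0` forces `accepting`, and `demanding` forces weight `2`. -/
theorem exists_color_of_mem_node {k Δ : ℕ} {Y : Fin Δ → Set (Fin k × Pointer)}
    {o : Fin Δ → Fin k × Pointer} (hoY : ∀ i, o i ∈ Y i)
    (ho : (Finset.univ : Finset (Fin Δ)).val.map o ∈ (superweakColoring k Δ).node) :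
    ∃ c, (Finset.univ.filter fun i => weights (Y i) c = 0).card <
      min (k + 1) (Finset.univ.filter fun i => weights (Y i) c = 2).card := by
  obtain ⟨-, ⟨c, hc⟩, hcount⟩ := ho
  have hoc : ∀ i, (c, (o i).2) ∈ Y i := fun i => by
    rw [← hc (o i) (Multiset.mem_map_of_mem o (Finset.mem_univ i))]
    exact hoY i
  rw [countP_map_univ, countP_map_univ] at hcount
  refine ⟨c, lt_of_le_of_lt ?_ (lt_of_lt_of_le hcount (min_le_min le_rfl ?_))⟩
  · refine Finset.card_le_card fun i hi => ?_
    have h0 := (Finset.mem_filter.1 hi).2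
    refine Finset.mem_filter.2 ⟨Finset.mem_univ _, ?_⟩
    have hmem := hoc i
    cases hp : (o i).2 with
    | accepting => rfl
    | demanding => simp [weights, hp ▸ hmem] at h0
    | none =>
      simp only [weights, hp ▸ hmem, if_true] at h0
      split_ifs at h0 <;> exact absurd h0 (by decide)
  · refine Finset.card_le_card fun i hi => ?_
    have h0 : (o i).2 = .demanding := (Finset.mem_filter.1 hi).2
    refine Finset.mem_filter.2 ⟨Finset.mem_univ _, ?_⟩
    have := hoc i
    rw [h0] at this
    simp [weights, this]

/-! ### The faster algorithm -/

/-- The type of port `i` of `v`: its orientation according to the rule `out`, and the weights of the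
sets of outputs that are possible there given the radius-`t - 1` neighborhood of `v`. -/
noncomputable def portType {n Δ k : ℕ} {Λ : Type*} (A : Algorithm n Δ Λ (Fin k × Pointer))
    (𝒩 : Set (Network n Δ Λ)) (t : ℕ) (out : Λ → Bool) (I : Network n Δ Λ) (v : Fin n)
    (i : Fin Δ) : PortType k :=
  (out (I.portLabel v i),
    {y | ∃ J ∈ 𝒩, ∃ w, NodeSim (t - 1) I v J w ∧ weights (halfOutputs A 𝒩 t J w i) = y})

theorem portType_congr {n Δ k : ℕ} {Λ : Type*} {A : Algorithm n Δ Λ (Fin k × Pointer)}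
    {𝒩 : Set (Network n Δ Λ)} {t : ℕ} {out : Λ → Bool} {I J : Network n Δ Λ} {v w : Fin n}
    (h : NodeSim (t - 1) I v J w) : portType A 𝒩 t out I v = portType A 𝒩 t out J w := by
  funext i
  refine Prod.ext ?_ ?_
  · obtain ⟨φ, rfl, hφ⟩ := h
    exact congrArg out (hφ.label_eq v (I.mem_nodeNbhd_self _ v) i).symm
  · ext y
    constructor
    · rintro ⟨K, hK, x, hx, rfl⟩
      exact ⟨K, hK, x, h.symm.trans hx, rfl⟩
    · rintro ⟨K, hK, x, hx, rfl⟩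
      exact ⟨K, hK, x, h.trans hx, rfl⟩

theorem out_portLabel_ne {n Δ : ℕ} {Λ : Type*} {P : PortedGraph n Δ Λ} {out : Λ → Bool}
    (hout : ∀ d : P.graph.Dart, out (P.label d.symm) = !(out (P.label d))) {v : Fin n}
    {i j : Fin Δ} (hj : P.nbr (P.nbr v i) j = v) :
    out (P.portLabel v i) ≠ out (P.portLabel (P.nbr v i) j) := by
  have h1 : P.portLabel (P.nbr v i) j =
      P.label (SimpleGraph.Dart.symm ⟨(v, P.nbr v i), P.adj_nbr v i⟩) := by
    refine congrArg P.label (SimpleGraph.Dart.ext _ _ ?_)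
    exact Prod.ext rfl hj
  have h2 : P.portLabel v i = P.label ⟨(v, P.nbr v i), P.adj_nbr v i⟩ := rfl
  rw [h1, hout, ← h2]
  simp

open Classical in
/-- Ports with a type in `D` demand, and ports that may be at the other end of such an edge
accept. -/
noncomputable def pointerOf {k : ℕ} (D : Set (PortType k)) (a : PortType k) : Pointer :=
  if ∃ b ∈ D, Linked b a then .accepting else if a ∈ D then .demanding else .none

theorem pointerOf_eq_accepting_iff {k : ℕ} {D : Set (PortType k)} {a : PortType k} :
    pointerOf D a = .accepting ↔ ∃ b ∈ D, Linked b a := by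
  unfold pointerOf
  split_ifs with h <;> simp [h]

theorem pointerOf_eq_demanding_iff {k : ℕ} {D : Set (PortType k)} {s : Bool}
    (hD : ∀ a ∈ D, a.1 = s) {a : PortType k} : pointerOf D a = .demanding ↔ a ∈ D := by
  unfold pointerOf
  split_ifs with h h'
  · obtain ⟨b, hb, hl⟩ := h
    simp only [false_iff]
    exact fun ha => hl.1 ((hD b hb).trans (hD a ha).symm)
  · simpa
  · simpa

/-- The two ends of an edge agree to have no pointers, or one end accepts, if both use the same
set `D`. -/
theorem pointerOf_of_linked {k : ℕ} {D : Set (PortType k)} {a b : PortType k} (h : Linked a b) :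
    (pointerOf D a = .none ∧ pointerOf D b = .none) ∨
      pointerOf D a = .accepting ∨ pointerOf D b = .accepting := by
  by_cases ha : ∃ c ∈ D, Linked c a
  · exact Or.inr (Or.inl (pointerOf_eq_accepting_iff.2 ha))
  by_cases hb : ∃ c ∈ D, Linked c b
  · exact Or.inr (Or.inr (pointerOf_eq_accepting_iff.2 hb))
  have ha' : a ∉ D := fun h' => hb ⟨a, h', h⟩
  have hb' : b ∉ D := fun h' => ha ⟨b, h', h.symm⟩
  exact Or.inl ⟨by simp only [pointerOf, if_neg ha, if_neg ha'],
    by simp only [pointerOf, if_neg hb, if_neg hb']⟩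

theorem map_mem_superweakColoring_node {k K Δ : ℕ} {τ : Fin Δ → PortType k}
    {D : Set (PortType k)} (hD : IsViolator K τ D) (c : Fin K) :
    (Finset.univ : Finset (Fin Δ)).val.map (fun i => (c, pointerOf D (τ i))) ∈
      (superweakColoring K Δ).node := by
  classical
  obtain ⟨⟨s, hs⟩, hlt⟩ := hD
  refine ⟨by simp, ⟨c, by simp⟩, ?_⟩
  rw [countP_map_univ, countP_map_univ]
  simp only [pointerOf_eq_accepting_iff, pointerOf_eq_demanding_iff hs]
  convert hlt

open Classical in
/-- A violator for the port types `τ`, or the empty set if there is none. -/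
noncomputable def violator {k Δ : ℕ} (K : ℕ) (τ : Fin Δ → PortType k) : Set (PortType k) :=
  if h : ∃ D, IsViolator K τ D then h.choose else ∅

end SuperweakSpeedup

open SuperweakSpeedup in
theorem mainTheorem6 {Λ : Type*} [Finite Λ] (k : ℕ) (hk : 2 ≤ k)
    (Δ : ℕ) (hΔ : 2 ^ (4 ^ k + 1) ≤ Δ) (n t : ℕ) (ht : 1 ≤ t)
    (𝒢 : Set (SuperweakSpeedup.LabeledGraph n Λ))
    (hreg : ∀ G ∈ 𝒢, G.IsRegular Δ)
    (horient : SuperweakSpeedup.ContainsOrientation 𝒢)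
    (hindep : SuperweakSpeedup.IsIndependent Δ 𝒢 t)
    (hgirth : ∀ G ∈ 𝒢, ((2 * t + 2 : ℕ) : ℕ∞) ≤ G.graph.egirth)
    (S : Finset ℕ+) (hS : 4 * Δ ^ (2 * t) ≤ S.card)
    (halg : SuperweakSpeedup.OrderInvariantlySolvable
      (SuperweakSpeedup.superweakColoring k Δ) (SuperweakSpeedup.withIdents Δ 𝒢 S) t) :
    SuperweakSpeedup.OrderInvariantlySolvable
      (SuperweakSpeedup.superweakColoring (2 ^ (2 ^ (5 ^ k))) Δ)
      (SuperweakSpeedup.withIdents Δ 𝒢 S) (t - 1) := by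
  obtain ⟨A, -, hA, hsol⟩ := halg
  obtain ⟨out, hout⟩ := horient
  obtain ⟨code, hcode⟩ := exists_injective_color hk
  have hcard := mul_card_portType_le hk
  generalize 2 ^ (2 ^ (5 ^ k)) = K at code hcode hcard ⊢
  set 𝒩 := withIdents Δ 𝒢 S with h𝒩
  let τ := portType A 𝒩 t out
  have hinv : IsOrderInvariant
      (fun I v i => (code (violator K (τ I v)), pointerOf (violator K (τ I v)) (τ I v i)))
      𝒩 (t - 1) := by
    intro I _ J _ v w φ hφ hlt
    have h : τ I v = τ J w := portType_congr ⟨φ, hφ.1, hφ.2, hlt⟩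
    simp only [h]
  refine ⟨_, ?_, hinv, fun I hI => ⟨fun v => ?_, fun v i j hj => ?_⟩⟩
  · intro I hI J hJ v w φ hφ hid
    exact hinv I hI J hJ v w φ hφ fun x hx y hy => by rw [hid x hx, hid y hy]
  · -- All selections from the possible weights occur at a node on which `A` is correct.
    have hviol : ∃ D, IsViolator K (τ I v) D := by
      refine exists_isViolator K (τ I v) hcard fun y hy => ?_
      choose J hJ w hsim hyw using hy
      obtain ⟨N, hN, x, hx⟩ :=
        exists_halfOutputs_eq (A := A) ht hindep.2 hgirth hI hJ hsim
      obtain ⟨c, hc⟩ := exists_color_of_mem_node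
        (Y := fun i => halfOutputs A 𝒩 t N x i)
        (fun i => ⟨N, hN, x, .refl t i N x, rfl⟩) ((hsol N hN).1 x)
      simp only [h𝒩, hx] at hc
      simp only [h𝒩] at hyw
      simp only [hyw] at hc
      exact ⟨c, by convert hc⟩
    have hD : IsViolator K (τ I v) (violator K (τ I v)) := by
      rw [violator, dif_pos hviol]
      exact hviol.choose_spec
    exact map_mem_superweakColoring_node hD _
  · -- The actual sets of possible outputs show that the two port types are linked.
    refine ⟨_, _, _, _, rfl, ?_⟩
    by_cases hc : violator K (τ I v) = violator K (τ I (I.nbr v i))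
    · right
      have hlink : Linked (τ I v i) (τ I (I.nbr v i) j) :=
        ⟨out_portLabel_ne (hout _ hI.1) hj,
          _, ⟨I, hI, v, .refl _ I v, rfl⟩, _, ⟨I, hI, _, .refl _ I _, rfl⟩,
          fits_weights (Δ := Δ) fun y hy z hz =>
            mem_edge_of_mem_halfOutputs ht hindep.1 hA hsol hI hj hy hz⟩
      rw [← hc]
      exact pointerOf_of_linked hlink
    · exact Or.inl fun h => hc (hcode h)
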